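/- **Proposition 3.2.** Let $n,m,n',m'\ge 0$ be integers, and let $f:\mathbb R^n\times\mathbb R^m\to\mathbb R^n$ and $g:\mathbb R^{n'}\times\mathbb R^{m'}\to\mathbb R^{n'}$ be continuous. Consider the control systems $\dot x=f(x,u)$ with state $x\in\mathbb R^n$ and control $u\in\mathbb R^m$, and $\dot z=g(z,v)$ with state $z\in\mathbb R^{n'}$ and control $v\in\mathbb R^{m'}$. For an open set $\Omega\subset\mathbb R^{n}\times\mathbb R^{m}$, a *solution of $\dot x=f(x,u)$ that remains in $\Omega$* is a map $\gamma=(\gamma_{\mathrm I},\gamma_{\mathrm{II}}):I\to\Omega$ on a real interval $I$, with $\gamma_{\mathrm I}(t)\in\mathbb R^n$ and $\gamma_{\mathrm{II}}(t)\in\mathbb R^m$, such that $\gamma$ is Lebesgue measurable and locally bounded (every $t\in I$ has a neighbourhood in $I$ on which $\gamma$ is bounded), $\gamma_{\mathrm I}$ is absolutely continuous on every compact subinterval of $I$, and $$\gamma_{\mathrm I}(T_2)-\gamma_{\mathrm I}(T_1)=\int_{T_1}^{T_2} f(\gamma_{\mathrm I}(t),\gamma_{\mathrm{II}}(t))\,dt\qquad\text{whenever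 }[T_1,T_2]\subset I .$$ Solutions of $\dot z=g(z,v)$ that remain in an open set $\Omega'\subset\mathbb R^{n'}\times\mathbb R^{m'}$ are defined likewise. A bijection $\chi:\Omega\to\Omega'$ *conjugates* the two systems if, for every real interval $I$, a map $\gamma:I\to\Omega$ is a solution of $\dot x=f(x,u)$ that remains in $\Omega$ if and only if $\chi\circ\gamma$ is a solution of $\dot z=g(z,v)$ that remains in $\Omega'$. Write $\Omega_{\mathbb R^n}\subset\mathbb R^n$ and $\Omega'_{\mathbb R^{n'}}\subset\mathbb R^{n'}$ for the projections of $\Omega$ and $\Omega'$ onto the state spaces. Let $\Omega\subset\mathbb R^{n}\times\mathbb R^{m}$ and $\Omega'\subset\mathbb R^{n'}\times\mathbb R^{m'}$ be open with $\Omega\neq\emptyset$, and let $\chi=(\chi_{\mathrm I},\chi_{\mathrm{II}}):\Omega\to\Omega'$ be a homeomorphism that conjugates the two systems, where $\chi_{\mathrm I}(x,u)\in\mathbb R^{n'}$ and $\chi_{\mathrm{II}}(x,u)\in\mathbb R^{m'}$. Then $n=n'$ and $m=m'$; $\chi_{\mathrm I}$ depends only on $x$, so that $$\chi(x,u)=(\chi_{\mathrm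 I}(x),\chi_{\mathrm{II}}(x,u)),\qquad (x,u)\in\Omega;$$ and the induced map $\chi_{\mathrm I}:\Omega_{\mathbb R^n}\to\Omega'_{\mathbb R^{n'}}$ is a homeomorphism. -/

import Mathlib

open Set MeasureTheory Topology

namespace ControlSystem

/-- The state-control space `ℝⁿ × ℝᵐ`, both factors being Euclidean spaces. -/
abbrev StateControl (n m : ℕ) : Type :=
  EuclideanSpace ℝ (Fin n) × EuclideanSpace ℝ (Fin m)

/-- `IsSolution f Ω I γ`: the restriction of `γ = (γ_I, γ_II)` to the set `I` (a real interval in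
all uses) is a solution of the control system `ẋ = f (x, u)` that remains in `Ω`. Only the values
of `γ` on `I` matter. Measurability is Lebesgue measurability on `I`; absolute continuity on the
interval is absolute continuity on each of its compact subintervals. -/
structure IsSolution {n m : ℕ} (f : StateControl n m → EuclideanSpace ℝ (Fin n))
    (Ω : Set (StateControl n m)) (I : Set ℝ) (γ : ℝ → StateControl n m) : Prop where
  mapsTo : MapsTo γ I Ω
  measurable : AEMeasurable γ (volume.restrict I)
  locallyBounded : ∀ t ∈ I, ∃ s ∈ 𝓝[I] t, Bornology.IsBounded (γ '' s)
  absolutelyContinuous : ∀ T₁ T₂ : ℝ, T₁ ≤ T₂ → Icc T₁ T₂ ⊆ I →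
    AbsolutelyContinuousOnInterval (fun t => (γ t).1) T₁ T₂
  integral_eq : ∀ T₁ T₂ : ℝ, T₁ ≤ T₂ → Icc T₁ T₂ ⊆ I →
    (γ T₂).1 - (γ T₁).1 = ∫ t in T₁..T₂, f (γ t)

/-- The homeomorphism `χ` from the open set `χ.source` onto the open set `χ.target` conjugates the
systems `ẋ = f (x, u)` and `ż = g (z, v)`: for every real interval `I`, a map `γ : I → χ.source`
is a solution of the former that remains in `χ.source` if and only if `χ ∘ γ` is a solution of the
latter that remains in `χ.target`. -/
def Conjugates {n m n' m' : ℕ}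
    (χ : OpenPartialHomeomorph (StateControl n m) (StateControl n' m'))
    (f : StateControl n m → EuclideanSpace ℝ (Fin n))
    (g : StateControl n' m' → EuclideanSpace ℝ (Fin n')) : Prop :=
  ∀ (I : Set ℝ), I.OrdConnected → ∀ γ : ℝ → StateControl n m, MapsTo γ I χ.source →
    (IsSolution f χ.source I γ ↔ IsSolution g χ.target I (fun t => χ (γ t)))

/-- The projection `Ω_{ℝⁿ}` of `Ω ⊆ ℝⁿ × ℝᵐ` onto the state space `ℝⁿ`. -/
def stateProj {n m : ℕ} (Ω : Set (StateControl n m)) : Set (EuclideanSpace ℝ (Fin n)) :=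
  Prod.fst '' Ω

end ControlSystem

/-! States evolve continuously while controls may jump. If `(x, u₁)` and `(x, u₂)` lie in `Ω`, some
solution passes through `x` at time 0 while its control switches from `u₁` to `u₂`. The state part
of its image under `χ` is absolutely continuous, so its left limit at 0, `χ_I(x, u₁)`, equals its
value there, `χ_I(x, u₂)` (`Conjugates.fst_eq`). Hence `χ_I` factors through the state; the same
argument for `χ⁻¹` gives the continuous inverse. Invariance of dimension, applied to the state map
and to `χ`, in both directions, yields `n = n'` and `n + m = n' + m'`. It is derived from the
absence of a `C¹` retraction of the ball onto the sphere, proved by a volume computation. The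
switching solution is glued from two Peano solutions, as `f` is only continuous. -/

/-! ### Invariance of dimension via the no-retraction theorem. -/

section InvarianceOfDimension

open Metric Module Polynomial

theorem exists_polynomial_eval_eq_det {E : Type*} [NormedAddCommGroup E] [NormedSpace ℝ E]
    [FiniteDimensional ℝ E] (A : E →L[ℝ] E) :
    ∃ P : ℝ[X], P.natDegree ≤ finrank ℝ E ∧
      ∀ t : ℝ, P.eval t = (ContinuousLinearMap.id ℝ E + t • A).det := by
  let b := finBasis ℝ E
  let M := LinearMap.toMatrix b b (A : E →ₗ[ℝ] E)
  refine ⟨Matrix.det ((X : ℝ[X]) • M.map C + (1 : Matrix _ _ ℝ).map C), ?_, fun t => ?_⟩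
  · simpa using Polynomial.natDegree_det_X_add_C_le M (1 : Matrix (Fin (finrank ℝ E)) _ ℝ)
  · rw [_root_.eval_det, ContinuousLinearMap.det, ← LinearMap.det_toMatrix b]
    congr 1
    ext i j
    rw [matPolyEquiv_eval]
    simp [M, LinearMap.toMatrix_apply, Matrix.one_apply, Finsupp.single_apply, eq_comm]
    split_ifs <;> simp <;> ring

/-- Lagrange interpolation at `p + 1` nodes. The weights do not depend on `P`, so the formula can be
integrated over a family of polynomials, carrying information from small `t` to `t = 1`. -/
theorem exists_eval_one_eq_sum_eval (p : ℕ) {δ : ℝ} (hδ : 0 < δ) :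
    ∃ v w : ℕ → ℝ, (∀ i, 0 < v i ∧ v i ≤ δ) ∧ ∀ P : ℝ[X], P.natDegree ≤ p →
      P.eval 1 = ∑ i ∈ Finset.range (p + 1), w i * P.eval (v i) := by
  let v : ℕ → ℝ := fun i => δ / (i + 1)
  have hv : Function.Injective v := by
    intro i j h
    have h' : δ / (i + 1 : ℝ) = δ / (j + 1) := h
    rw [div_eq_div_iff (by positivity) (by positivity)] at h'
    exact_mod_cast (add_right_cancel (mul_left_cancel₀ hδ.ne' h')).symm
  refine ⟨v, fun i => (Lagrange.basis (Finset.range (p + 1)) v i).eval 1, fun i => ⟨by positivity,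
    div_le_self hδ.le (by linarith [i.cast_nonneg (α := ℝ)])⟩, fun P hP => ?_⟩
  have h := Lagrange.eq_interpolate (f := P) (s := Finset.range (p + 1)) (v := v) hv.injOn (by
    rw [Finset.card_range]
    exact (degree_le_of_natDegree_le hP).trans_lt (by exact_mod_cast p.lt_succ_self))
  conv_lhs => rw [h]
  simp [Lagrange.interpolate_apply, eval_finsetSum, mul_comm]

/-- A segment leaving the ball crosses the sphere, where `ψ` vanishes, so the Lipschitz constant on
the closed ball also serves for the extension by zero. -/
theorem exists_lipschitzWith_of_eq_zero_outside_ball {E : Type*} [NormedAddCommGroup E]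
    [NormedSpace ℝ E] [FiniteDimensional ℝ E] {ψ : E → E} (hψ : ContDiff ℝ 1 ψ)
    (h0 : ∀ x, ‖x‖ = 1 → ψ x = 0) :
    ∃ K, LipschitzWith K ((ball (0 : E) 1).indicator ψ) := by
  obtain ⟨K, hK⟩ := hψ.contDiffOn.exists_lipschitzOnWith (by decide) (convex_closedBall (0 : E) 1)
    (isCompact_closedBall (0 : E) 1)
  have key : ∀ x ∈ ball (0 : E) 1, ∀ y ∉ ball (0 : E) 1, ‖ψ x‖ ≤ K * ‖x - y‖ := by
    intro x hx y hy
    rw [mem_ball_zero_iff] at hx hy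
    obtain ⟨t, ht, hz⟩ : (1 : ℝ) ∈ (fun t : ℝ => ‖AffineMap.lineMap x y t‖) '' Icc (0 : ℝ) 1 := by
      apply intermediate_value_Icc zero_le_one
      · exact (AffineMap.lineMap_continuous.norm).continuousOn
      · simp [hx.le, not_lt.1 hy]
    set z := AffineMap.lineMap x y t
    have hz' : ‖z‖ = 1 := hz
    have h1 := hK.dist_le_mul x (by simp [hx.le]) z (by simp [hz'])
    rw [h0 z hz', dist_zero_right, dist_left_lineMap, dist_eq_norm] at h1
    refine h1.trans (mul_le_mul_of_nonneg_left ?_ K.2)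
    rw [Real.norm_of_nonneg ht.1]
    exact mul_le_of_le_one_left (norm_nonneg _) ht.2
  refine ⟨K, LipschitzWith.of_dist_le_mul fun x y => ?_⟩
  by_cases hx : x ∈ ball (0 : E) 1 <;> by_cases hy : y ∈ ball (0 : E) 1
  · simpa [indicator_of_mem hx, indicator_of_mem hy] using
      hK.dist_le_mul x (ball_subset_closedBall hx) y (ball_subset_closedBall hy)
  · simpa [indicator_of_mem hx, indicator_of_notMem hy, dist_eq_norm] using key x hx y hy
  · simpa [indicator_of_mem hy, indicator_of_notMem hx, dist_eq_norm, norm_sub_rev]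
      using key y hy x hx
  · simp only [indicator_of_notMem hx, indicator_of_notMem hy, dist_self]
    positivity

/-- A small compactly supported Lipschitz perturbation of the identity maps the unit ball
bijectively onto itself. -/
theorem bijOn_ball_id_add_of_lipschitzWith {E : Type*} [NormedAddCommGroup E]
    [NormedSpace ℝ E] [FiniteDimensional ℝ E] {ψ : E → E} {K : NNReal} (hK : LipschitzWith K ψ)
    (hK1 : K < 1) (h0 : ∀ x ∉ ball (0 : E) 1, ψ x = 0) :
    BijOn (fun x => x + ψ x) (ball 0 1) (ball 0 1) := by
  -- In the zero space the identity has norm 0, so `hc` would fail.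
  rcases subsingleton_or_nontrivial E with hE | hE
  · have : (fun x => x + ψ x) = id := by ext x; exact Subsingleton.elim _ _
    rw [this]
    exact bijOn_id _
  have hap : ApproximatesLinearOn (fun x => x + ψ x)
      ((ContinuousLinearEquiv.refl ℝ E : E ≃L[ℝ] E) : E →L[ℝ] E) univ K := by
    intro x _ y _
    have := hK.dist_le_mul x y
    rw [dist_eq_norm, dist_eq_norm] at this
    simpa [add_sub_add_comm] using this
  have hc : K < ‖(((ContinuousLinearEquiv.refl ℝ E : E ≃L[ℝ] E).symm : E →L[ℝ] E))‖₊⁻¹ := by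
    have : ‖(((ContinuousLinearEquiv.refl ℝ E : E ≃L[ℝ] E).symm : E →L[ℝ] E))‖₊ = 1 := by
      ext
      exact ContinuousLinearMap.norm_id
    rw [this, inv_one]; exact hK1
  have hinj : Function.Injective fun x => x + ψ x :=
    injOn_univ.1 (hap.injOn (Or.inr hc))
  have hsurj := (hap.surjective (Or.inr hc))
  have hout : ∀ x ∉ ball (0 : E) 1, x + ψ x = x := fun x hx => by rw [h0 x hx, add_zero]
  refine ⟨fun x hx => ?_, hinj.injOn, fun y hy => ?_⟩
  · by_contra hx'
    have := hinj (a₁ := x + ψ x) (a₂ := x) (hout _ hx')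
    exact hx' (show x + ψ x ∈ ball 0 1 by rwa [this])
  · obtain ⟨x, rfl⟩ := hsurj y
    refine ⟨x, ?_, rfl⟩
    by_contra hx
    have := hout x hx
    simp only [this] at hy
    exact hx hy

/-- There is no continuously differentiable retraction of the unit ball onto the unit sphere. -/
theorem not_contDiff_retraction_sphere {E : Type*} [NormedAddCommGroup E] [InnerProductSpace ℝ E]
    [FiniteDimensional ℝ E] {r : E → E} (hr : ContDiff ℝ 1 r)
    (hn : ∀ x, ‖r x‖ = 1) (hs : ∀ x, ‖x‖ = 1 → r x = x) : False := by
  let _ : MeasurableSpace E := borel E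
  have _ : BorelSpace E := ⟨rfl⟩
  -- For small `t`, `x + t ψ(x)` permutes the ball, so its Jacobian integrates to the volume. The
  -- Jacobian is polynomial in `t`, so this persists at `t = 1`, where the map is `r` and the
  -- Jacobian vanishes.
  let ψ : E → E := fun x => r x - x
  have hψ : ContDiff ℝ 1 ψ := hr.sub contDiff_id
  obtain ⟨K, hK⟩ := exists_lipschitzWith_of_eq_zero_outside_ball hψ
    (fun x hx => by simp [ψ, hs x hx])
  let A : E → E →L[ℝ] E := fderiv ℝ ψ
  have hA : Continuous A := hψ.continuous_fderiv one_ne_zero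
  have hdet : Continuous (ContinuousLinearMap.det : (E →L[ℝ] E) → ℝ) :=
    ContinuousLinearMap.continuous_det
  obtain ⟨ε, hε, hdε⟩ : ∃ ε > 0, ∀ B : E →L[ℝ] E, ‖B‖ < ε →
      0 < (ContinuousLinearMap.id ℝ E + B).det := by
    have h1 : ∀ᶠ B in 𝓝 (0 : E →L[ℝ] E), 0 < (ContinuousLinearMap.id ℝ E + B).det := by
      refine (hdet.comp (continuous_const.add continuous_id)).continuousAt.eventually
        (lt_mem_nhds ?_)
      simp [ContinuousLinearMap.det]
    obtain ⟨ε, hε, h⟩ := Metric.eventually_nhds_iff.1 h1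
    exact ⟨ε, hε, fun B hB => h (by simpa using hB)⟩
  obtain ⟨C, hC⟩ := (isCompact_closedBall (0 : E) 1).exists_bound_of_continuousOn hA.continuousOn
  have hC0 : 0 ≤ C := (norm_nonneg _).trans (hC 0 (by simp))
  -- The first bound keeps the Jacobian positive, the second makes `t ψ` a contraction; halving
  -- makes both strict.
  let δ : ℝ := min (ε / (C + 1)) (1 / (K + 1)) / 2
  have hδ : 0 < δ := by positivity
  have hδε : δ < ε / (C + 1) := (half_lt_self (by positivity)).trans_le (min_le_left _ _)
  have hδK : δ < 1 / (K + 1) := (half_lt_self (by positivity)).trans_le (min_le_right _ _)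
  have hvol : ∀ t : ℝ, 0 < t → t ≤ δ →
      ∫ x in ball (0 : E) 1, (ContinuousLinearMap.id ℝ E + t • A x).det =
        volume.real (ball (0 : E) 1) := by
    intro t ht htδ
    have hbij : BijOn (fun x => x + t • (ball (0 : E) 1).indicator ψ x) (ball 0 1) (ball 0 1) := by
      have hlip : LipschitzWith (‖t‖₊ * K) (fun x => t • (ball (0 : E) 1).indicator ψ x) :=
        (lipschitzWith_smul t).comp hK
      refine bijOn_ball_id_add_of_lipschitzWith hlip ?_ (fun x hx => by
        simp [indicator_of_notMem hx])
      rw [← NNReal.coe_lt_coe]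
      push_cast
      rw [Real.norm_of_nonneg ht.le]
      have := htδ.trans_lt hδK
      rw [lt_div_iff₀ (by positivity)] at this
      nlinarith [K.2]
    have hbij' : BijOn (fun x => x + t • ψ x) (ball (0 : E) 1) (ball 0 1) :=
      hbij.congr fun x hx => by simp [indicator_of_mem hx]
    have hderiv : ∀ x ∈ ball (0 : E) 1, HasFDerivWithinAt (fun x => x + t • ψ x)
        (ContinuousLinearMap.id ℝ E + t • A x) (ball (0 : E) 1) x := fun x _ =>
      ((hasFDerivAt_id x).add
        (((hψ.differentiable one_ne_zero x).hasFDerivAt).const_smul t)).hasFDerivWithinAt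
    have := integral_image_eq_integral_abs_det_fderiv_smul volume measurableSet_ball hderiv
      hbij'.injOn (fun _ => (1 : ℝ))
    rw [hbij'.image_eq] at this
    simp only [integral_const, smul_eq_mul, mul_one, measureReal_restrict_apply_univ] at this
    rw [this]
    refine setIntegral_congr_fun measurableSet_ball fun x hx => ?_
    refine (abs_of_pos (hdε _ ?_)).symm
    rw [norm_smul, Real.norm_of_nonneg ht.le]
    have h1 := hC x (ball_subset_closedBall hx)
    have h2 := htδ.trans_lt hδε
    rw [lt_div_iff₀ (by positivity)] at h2
    nlinarith
  obtain ⟨v, w, hv, hw⟩ := exists_eval_one_eq_sum_eval (finrank ℝ E) hδ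
  have hsum : ∀ x, (ContinuousLinearMap.id ℝ E + (1 : ℝ) • A x).det =
      ∑ i ∈ Finset.range (finrank ℝ E + 1), w i * (ContinuousLinearMap.id ℝ E + v i • A x).det := by
    intro x
    obtain ⟨P, hP, hPe⟩ := exists_polynomial_eval_eq_det (A x)
    simpa only [hPe] using hw P hP
  have hwsum : ∑ i ∈ Finset.range (finrank ℝ E + 1), w i = 1 := by
    simpa using (hw 1 (by simp)).symm
  have hint : ∀ t : ℝ, IntegrableOn (fun x => (ContinuousLinearMap.id ℝ E + t • A x).det)
      (ball (0 : E) 1) := fun t =>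
    ((hdet.comp (continuous_const.add (hA.const_smul t))).continuousOn.integrableOn_compact
      (isCompact_closedBall (0 : E) 1)).mono_set ball_subset_closedBall
  have hone : ∫ x in ball (0 : E) 1, (ContinuousLinearMap.id ℝ E + (1 : ℝ) • A x).det =
      volume.real (ball (0 : E) 1) := by
    simp_rw [hsum]
    rw [integral_finsetSum _ fun i _ => (hint (v i)).const_mul (w i)]
    simp_rw [integral_const_mul, fun i => hvol (v i) (hv i).1 (hv i).2]
    rw [← Finset.sum_mul, hwsum, one_mul]
  -- Differentiating `‖r‖² = 1` shows that the range of the derivative is orthogonal to `r x ≠ 0`.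
  have hzero : ∀ x, (ContinuousLinearMap.id ℝ E + (1 : ℝ) • A x).det = 0 := by
    intro x
    have hrA : HasFDerivAt r (ContinuousLinearMap.id ℝ E + (1 : ℝ) • A x) x := by
      have := (hasFDerivAt_id x).add (hψ.differentiable one_ne_zero x).hasFDerivAt
      rw [one_smul]
      convert this using 1
      ext y
      simp [ψ]
    set B := ContinuousLinearMap.id ℝ E + (1 : ℝ) • A x
    by_contra hB
    obtain ⟨y, hy⟩ : ∃ y, B y = r x := by
      have : IsUnit (LinearMap.det (B : E →ₗ[ℝ] E)) := isUnit_iff_ne_zero.2 hB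
      exact LinearMap.range_eq_top.1 ((LinearMap.isUnit_iff_range_eq_top _).1
        ((LinearMap.isUnit_iff_isUnit_det _).2 this)) (r x)
    have hnorm : HasFDerivAt (fun x => inner ℝ (r x) (r x)) (0 : E →L[ℝ] ℝ) x := by
      have : (fun x => inner ℝ (r x) (r x)) = fun _ => (1 : ℝ) := by
        ext x
        rw [real_inner_self_eq_norm_sq, hn]; norm_num
      rw [this]
      exact hasFDerivAt_const _ _
    have h2 := (hrA.inner ℝ hrA).unique hnorm
    have h3 := congrArg (fun L : E →L[ℝ] ℝ => L y) h2
    simp [hy, hn] at h3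
  simp only [hzero, integral_zero] at hone
  have hpos : 0 < volume.real (ball (0 : E) 1) :=
    ENNReal.toReal_pos (measure_ball_pos _ _ one_pos).ne' measure_ball_lt_top.ne
  exact hpos.ne hone

/-- A continuous self-map of Euclidean space that is close to the identity on the unit ball
has a zero there. -/
theorem exists_zero_of_norm_sub_le {E : Type*} [NormedAddCommGroup E] [InnerProductSpace ℝ E]
    [FiniteDimensional ℝ E] {h : E → E} (hc : Continuous h)
    (hh : ∀ x, ‖x‖ ≤ 1 → ‖h x - x‖ ≤ 1 / 2) : ∃ x, ‖x‖ ≤ 1 ∧ h x = 0 := by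
  by_contra! hne
  obtain ⟨δ, hδ, hδh⟩ : ∃ δ > 0, ∀ x ∈ closedBall (0 : E) 1, δ ≤ ‖h x‖ := by
    obtain ⟨x, hx, hmin⟩ := (isCompact_closedBall (0 : E) 1).exists_isMinOn ⟨0, by simp⟩
      hc.norm.continuousOn
    exact ⟨‖h x‖, norm_pos_iff.2 (hne x (by simpa using hx)), fun y hy => hmin hy⟩
  obtain ⟨s, hs, hsh, -⟩ := hc.exists_contDiff_approx 1 (ε := fun _ => min δ (1 / 4))
    continuous_const (fun _ => by positivity)
  have hsn : ∀ x, ‖x‖ ≤ 1 → s x ≠ 0 := by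
    intro x hx h0
    have h1 := (hsh x).trans_le (min_le_left _ _)
    rw [h0, dist_zero_left] at h1
    exact absurd (hδh x (by simpa using hx)) (not_le.2 h1)
  have hsx : ∀ x, ‖x‖ ≤ 1 → ‖s x - x‖ < 3 / 4 := by
    intro x hx
    have h1 := (hsh x).trans_le (min_le_right _ _)
    rw [dist_eq_norm] at h1
    calc ‖s x - x‖ = ‖(s x - h x) + (h x - x)‖ := by congr 1; abel
      _ ≤ ‖s x - h x‖ + ‖h x - x‖ := norm_add_le _ _
      _ < 3 / 4 := by linarith [hh x hx]
  -- `φ` equals `s` for `‖x‖ ≤ 3/4` and the identity for `‖x‖ ≥ 1`. In between, `‖s x - x‖ < 3/4 <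
  -- ‖x‖` prevents zeros, so `φ / ‖φ‖` is a forbidden retraction.
  let η : ContDiffBump (0 : E) := ⟨3 / 4, 1, by norm_num, by norm_num⟩
  let φ : E → E := fun x => x + η x • (s x - x)
  have hφ : ContDiff ℝ 1 φ := contDiff_id.add (η.contDiff.smul (hs.sub contDiff_id))
  have hφout : ∀ x, 1 ≤ ‖x‖ → φ x = x := by
    intro x hx
    have : η x = 0 := η.zero_of_le_dist (by simpa using hx)
    simp [φ, this]
  have hφ0 : ∀ x, φ x ≠ 0 := by
    intro x h0
    rcases le_or_gt 1 ‖x‖ with hx | hx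
    · rw [hφout x hx] at h0
      rw [h0, norm_zero] at hx
      linarith
    rcases le_or_gt ‖x‖ (3 / 4) with hx' | hx'
    · have : η x = 1 := η.one_of_mem_closedBall (by simpa using hx')
      simp only [φ, this, one_smul, add_sub_cancel] at h0
      exact hsn x hx.le h0
    · have h1 : x = -(η x • (s x - x)) := eq_neg_of_add_eq_zero_left h0
      have h2 : ‖x‖ ≤ ‖s x - x‖ := by
        conv_lhs => rw [h1, norm_neg, norm_smul, Real.norm_of_nonneg η.nonneg]
        exact mul_le_of_le_one_left (norm_nonneg _) η.le_one
      linarith [hsx x hx.le]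
  refine not_contDiff_retraction_sphere (r := fun x => ‖φ x‖⁻¹ • φ x)
    (((hφ.norm ℝ hφ0).inv fun x => norm_ne_zero_iff.2 (hφ0 x)).smul hφ)
    (fun x => ?_) (fun x hx => ?_)
  · rw [norm_smul, norm_inv, norm_norm, inv_mul_cancel₀ (norm_ne_zero_iff.2 (hφ0 x))]
  · simp only [hφout x hx.ge, hx, inv_one, one_smul]

/-- A continuous injective map on the unit ball of a Euclidean space does not lower dimension. -/
theorem finrank_le_of_injOn_closedBall {E F : Type*} [NormedAddCommGroup E]
    [InnerProductSpace ℝ E] [FiniteDimensional ℝ E] [NormedAddCommGroup F] [NormedSpace ℝ F]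
    [FiniteDimensional ℝ F] {φ : E → F} (hφ : ContinuousOn φ (closedBall 0 1))
    (hinj : InjOn φ (closedBall 0 1)) : finrank ℝ E ≤ finrank ℝ F := by
  by_contra! hlt
  let B := closedBall (0 : E) 1
  have : CompactSpace B := isCompact_iff_compactSpace.1 (isCompact_closedBall 0 1)
  have hemb : IsClosedEmbedding (fun x : B => φ x) :=
    (continuousOn_iff_continuous_domRestrict.1 hφ).isClosedEmbedding
      (fun x y hxy => Subtype.ext (hinj x.2 y.2 hxy))
  -- Tietze extends `φ⁻¹` to `G` and `φ` to `Φ`. A smooth approximation `s` of `G` misses some small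
  -- `c` because the dimension rises from `F` to `E`, yet `s ∘ Φ - c` is close to the identity on
  -- the ball and so has a zero.
  obtain ⟨G, hG⟩ := ContinuousMap.exists_extension' hemb ⟨((↑) : B → E), continuous_subtype_val⟩
  obtain ⟨Φ, hΦ⟩ := ContinuousMap.exists_extension'
    (isClosed_closedBall (x := (0 : E)) (ε := 1)).isClosedEmbedding_subtypeVal
    ⟨fun x : B => φ x, continuousOn_iff_continuous_domRestrict.1 hφ⟩
  obtain ⟨s, hs, hsG, -⟩ := G.continuous.exists_contDiff_approx 1 (ε := fun _ => 1 / 4)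
    continuous_const (fun _ => by norm_num)
  obtain ⟨c, hc, hc'⟩ := Metric.dense_iff.1
    (ContDiff.dense_compl_range_of_finrank_lt_finrank hs hlt) 0 (1 / 4) (by norm_num)
  obtain ⟨x, -, hx⟩ := exists_zero_of_norm_sub_le (h := fun x => s (Φ x) - c)
    ((hs.continuous.comp Φ.continuous).sub continuous_const) (fun x hx => by
      have hxB : x ∈ B := by simpa [B] using hx
      have h1 : Φ x = φ x := congrFun hΦ ⟨x, hxB⟩
      have h2 : G (φ x) = x := congrFun hG ⟨x, hxB⟩
      have h3 := hsG (Φ x)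
      rw [h1, h2, dist_eq_norm] at h3
      rw [mem_ball_zero_iff] at hc
      calc ‖s (Φ x) - c - x‖ = ‖(s (φ x) - x) - c‖ := by rw [h1]; congr 1; abel
        _ ≤ ‖s (φ x) - x‖ + ‖c‖ := norm_sub_le _ _
        _ ≤ 1 / 2 := by linarith)
  exact hc' ⟨Φ x, sub_eq_zero.1 hx⟩

/-- **Invariance of dimension**: a continuous injective map on a nonempty open subset of a
finite-dimensional space does not lower dimension. -/
theorem finrank_le_of_continuousOn_injOn {E F : Type*} [NormedAddCommGroup E]
    [NormedSpace ℝ E] [FiniteDimensional ℝ E] [NormedAddCommGroup F] [NormedSpace ℝ F]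
    [FiniteDimensional ℝ F] {U : Set E} (hU : IsOpen U) (hne : U.Nonempty) {φ : E → F}
    (hφ : ContinuousOn φ U) (hinj : InjOn φ U) : finrank ℝ E ≤ finrank ℝ F := by
  obtain ⟨x₀, hx₀⟩ := hne
  -- The ball lemma needs an inner product, whereas products such as `StateControl` carry the sup
  -- norm.
  let e : EuclideanSpace ℝ (Fin (finrank ℝ E)) ≃L[ℝ] E :=
    ContinuousLinearEquiv.ofFinrankEq (by simp)
  let a : ℝ → EuclideanSpace ℝ (Fin (finrank ℝ E)) → E := fun ε y => x₀ + ε • e y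
  obtain ⟨ε, hε, hεU⟩ : ∃ ε > 0, MapsTo (a ε) (closedBall 0 1) U := by
    obtain ⟨ρ, hρ, hρU⟩ := Metric.isOpen_iff.1 hU x₀ hx₀
    obtain ⟨C, hC⟩ := (isCompact_closedBall (0 : EuclideanSpace ℝ (Fin (finrank ℝ E))) 1)
      |>.exists_bound_of_continuousOn e.continuous.continuousOn
    have hC0 : 0 ≤ C := (norm_nonneg _).trans (hC 0 (by simp))
    refine ⟨ρ / (C + 1), by positivity, fun y hy => hρU ?_⟩
    rw [mem_ball, dist_eq_norm, add_sub_cancel_left, norm_smul, Real.norm_of_nonneg (by positivity),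
      div_mul_eq_mul_div, div_lt_iff₀ (by positivity)]
    nlinarith [hC y hy]
  have hcont : Continuous (a ε) := continuous_const.add (e.continuous.const_smul ε)
  have hai : Function.Injective (a ε) := fun y z hyz =>
    e.injective (smul_right_injective E hε.ne' (add_left_cancel hyz))
  have := finrank_le_of_injOn_closedBall (hφ.comp hcont.continuousOn hεU)
    (hinj.comp hai.injOn hεU)
  simpa using this

end InvarianceOfDimension

/-! ### Peano existence by smooth approximation and compactness. -/

section Peano

open Metric Filter ODE

/-- **Peano existence theorem** for an autonomous differential equation, in integral form. -/
theorem exists_eq_add_integral_of_continuous {E : Type*} [NormedAddCommGroup E] [NormedSpace ℝ E]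
    [FiniteDimensional ℝ E] {F : E → E} (hF : Continuous F) (x₀ : E) :
    ∃ T > 0, ∃ β : ℝ → E, Continuous β ∧
      ∀ t ∈ Icc (-T) T, β t = x₀ + ∫ s in (0 : ℝ)..t, F (β s) := by
  have : CompleteSpace E := FiniteDimensional.complete ℝ E
  have : ProperSpace E := FiniteDimensional.proper ℝ E
  obtain ⟨C, hC⟩ := (isCompact_closedBall x₀ 1).exists_bound_of_continuousOn hF.continuousOn
  have hC0 : 0 ≤ C := (norm_nonneg _).trans (hC x₀ (by simp))
  -- The extra 1 absorbs the approximation error, so `L` bounds every `G k` on the ball; over time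
  -- `1 / L` the approximate solutions stay in it.
  let L : NNReal := ⟨C + 1, by positivity⟩
  have hL0 : (0 : ℝ) < L := show 0 < C + 1 by positivity
  let T : ℝ := 1 / L
  have hT : 0 < T := by positivity
  let t₀ : Icc (-T) T := ⟨0, by simp [hT.le]⟩
  have hLT : (L : ℝ) * max (T - t₀) (t₀ - -T) ≤ (1 : NNReal) - (0 : NNReal) := by
    simp only [t₀, T, sub_zero, zero_sub, neg_neg, max_self, NNReal.coe_one, NNReal.coe_zero]
    exact (mul_one_div_cancel hL0.ne').le
  have happrox : ∀ k : ℕ, ∃ G : E → E, Continuous G ∧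
      (∀ x, dist (G x) (F x) < 1 / ((k : ℝ) + 1)) ∧ (∀ x ∈ closedBall x₀ 1, ‖G x‖ ≤ L) ∧
      ∃ α : FunSpace t₀ x₀ 0 L,
        ∀ t : Icc (-T) T, α t = x₀ + ∫ s in (0 : ℝ)..t, G (α.compProj s) := by
    intro k
    obtain ⟨G, hG, hGF, -⟩ := hF.exists_contDiff_approx 1 (ε := fun _ => 1 / ((k : ℝ) + 1))
      continuous_const (fun _ => by positivity)
    obtain ⟨K, hK⟩ := hG.contDiffOn.exists_lipschitzOnWith (by decide)
      (convex_closedBall x₀ 1) (isCompact_closedBall x₀ 1)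
    have hGL : ∀ x ∈ closedBall x₀ 1, ‖G x‖ ≤ L := by
      intro x hx
      have h1 := hGF x
      rw [dist_eq_norm] at h1
      have h2 : 1 / ((k : ℝ) + 1) ≤ 1 := by
        rw [div_le_one (by positivity)]
        linarith [k.cast_nonneg (α := ℝ)]
      calc ‖G x‖ ≤ ‖F x‖ + ‖G x - F x‖ := norm_le_insert' _ _
        _ ≤ C + 1 := add_le_add (hC x hx) (h1.le.trans h2)
    have hPL : IsPicardLindelof (fun _ => G) t₀ x₀ 1 0 L K := .of_time_independent hGL hK hLT
    obtain ⟨α, hα⟩ := FunSpace.exists_isFixedPt_next hPL (x := x₀) (by simp)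
    exact ⟨G, hG.continuous, hGF, hGL, α, (FunSpace.isFixedPt_next_iff hPL (by simp)).1 hα⟩
  choose G hG hGF hbound α hα using happrox
  let b : ℕ → BoundedContinuousFunction (Icc (-T) T) E := fun k =>
    BoundedContinuousFunction.mkOfCompact (α k).toContinuousMap
  have hball : ∀ k t, α k t ∈ closedBall x₀ 1 := fun k t => (α k).mem_closedBall hLT
  -- Arzelà–Ascoli: all approximate solutions lie in one ball and share the Lipschitz constant `L`.
  have hcomp : IsCompact (closure (range b)) := by
    refine BoundedContinuousFunction.arzela_ascoli (closedBall x₀ 1) (isCompact_closedBall _ _)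
      (range b) ?_ ?_
    · rintro _ t ⟨k, rfl⟩
      exact hball k t
    · refine (LipschitzWith.uniformEquicontinuous _ L ?_).equicontinuous
      rintro ⟨_, k, rfl⟩
      exact (α k).lipschitzWith
  obtain ⟨a, -, ν, hν, hlim⟩ := hcomp.tendsto_subseq
    (fun k => subset_closure (mem_range_self (f := b) k))
  have hpt : ∀ t, Tendsto (fun k => α (ν k) t) atTop (𝓝 (a t)) := fun t =>
    ((continuous_eval_const (F := BoundedContinuousFunction (Icc (-T) T) E) t).tendsto a).comp hlim
  have hle : -T ≤ T := by linarith
  refine ⟨T, hT, fun t => a (projIcc (-T) T hle t), a.continuous.comp continuous_projIcc,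
    fun t ht => ?_⟩
  have hvec : ∀ y : ℕ → E, ∀ z, Tendsto y atTop (𝓝 z) →
      Tendsto (fun k => G (ν k) (y k)) atTop (𝓝 (F z)) := by
    intro y z hy
    have h1 : Tendsto (fun k => F (y k)) atTop (𝓝 (F z)) := (hF.tendsto z).comp hy
    refine h1.congr_dist (squeeze_zero (fun _ => dist_nonneg)
      (fun k => ?_) (tendsto_one_div_add_atTop_nhds_zero_nat.comp hν.tendsto_atTop))
    rw [dist_comm]
    exact (hGF (ν k) (y k)).le
  have hint : Tendsto (fun k => ∫ s in (0 : ℝ)..t, G (ν k) ((α (ν k)).compProj s)) atTop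
      (𝓝 (∫ s in (0 : ℝ)..t, F (a (projIcc (-T) T hle s)))) := by
    refine intervalIntegral.tendsto_integral_filter_of_dominated_convergence (fun _ => (L : ℝ))
      (.of_forall fun k => ?_) (.of_forall fun k => .of_forall fun s _ => ?_)
      intervalIntegrable_const (.of_forall fun s _ => ?_)
    · exact ((hG (ν k)).comp (α (ν k)).continuous_compProj).aestronglyMeasurable
    · exact hbound _ _ (hball _ _)
    · exact hvec _ _ (hpt _)
  have h1 := hpt ⟨t, ht⟩
  simp_rw [hα] at h1
  simp only [projIcc_of_mem hle ht]
  exact tendsto_nhds_unique h1 (tendsto_const_nhds.add hint)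

end Peano

theorem AbsolutelyContinuousOnInterval.congr {X : Type*} [PseudoMetricSpace X] {f g : ℝ → X}
    {a b : ℝ} (hf : AbsolutelyContinuousOnInterval f a b) (h : EqOn f g (uIcc a b)) :
    AbsolutelyContinuousOnInterval g a b := by
  refine Filter.Tendsto.congr' ?_ hf
  filter_upwards [Filter.mem_inf_of_right (Filter.mem_principal_self _)] with E hE
  refine Finset.sum_congr rfl fun i hi => ?_
  rw [h (hE.1 i hi).1, h (hE.1 i hi).2]

/-! ### Solutions, switching controls and conjugations. -/

namespace ControlSystem

variable {n m n' m' : ℕ}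

/-- Needed because `χ ∘ χ⁻¹ ∘ γ` agrees with `γ` only on `I`. -/
theorem IsSolution.congr {f : StateControl n m → EuclideanSpace ℝ (Fin n)}
    {Ω : Set (StateControl n m)} {I : Set ℝ} (hI : I.OrdConnected) {γ γ' : ℝ → StateControl n m}
    (h : IsSolution f Ω I γ) (hγ : EqOn γ γ' I) : IsSolution f Ω I γ' where
  mapsTo := h.mapsTo.congr hγ
  measurable := h.measurable.congr (ae_restrict_of_forall_mem hI.measurableSet hγ)
  locallyBounded t ht := by
    obtain ⟨s, hs, hb⟩ := h.locallyBounded t ht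
    refine ⟨s ∩ I, Filter.inter_mem hs self_mem_nhdsWithin, hb.subset ?_⟩
    rw [← (hγ.mono inter_subset_right).image_eq]
    exact image_mono inter_subset_left
  absolutelyContinuous T₁ T₂ hT hI' := (h.absolutelyContinuous T₁ T₂ hT hI').congr fun t ht => by
    simp only [hγ (hI' (uIcc_of_le hT ▸ ht))]
  integral_eq T₁ T₂ hT hI' := by
    rw [← hγ (hI' (left_mem_Icc.2 hT)), ← hγ (hI' (right_mem_Icc.2 hT)), h.integral_eq T₁ T₂ hT hI']
    refine intervalIntegral.integral_congr fun t ht => ?_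
    simp only [hγ (hI' (uIcc_of_le hT ▸ ht))]

theorem Conjugates.symm {χ : OpenPartialHomeomorph (StateControl n m) (StateControl n' m')}
    {f : StateControl n m → EuclideanSpace ℝ (Fin n)}
    {g : StateControl n' m' → EuclideanSpace ℝ (Fin n')} (h : Conjugates χ f g) :
    Conjugates χ.symm g f := by
  intro I hI γ hγ
  have hγ' : MapsTo γ I χ.target := hγ
  have heq : EqOn (fun t => χ (χ.symm (γ t))) γ I := fun t ht => χ.right_inv (hγ' ht)
  have hiff := h I hI (fun t => χ.symm (γ t)) (fun t ht => χ.map_target (hγ' ht))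
  exact ⟨fun hs => hiff.2 (IsSolution.congr hI hs heq.symm), fun hs => (hiff.1 hs).congr hI heq⟩

/-- Through every state there is a solution whose control switches between two given values. -/
theorem exists_isSolution_switch {f : StateControl n m → EuclideanSpace ℝ (Fin n)}
    (hf : Continuous f) {Ω : Set (StateControl n m)} (hΩ : IsOpen Ω) {x : EuclideanSpace ℝ (Fin n)}
    {u₁ u₂ : EuclideanSpace ℝ (Fin m)} (h₁ : (x, u₁) ∈ Ω) (h₂ : (x, u₂) ∈ Ω) :
    ∃ T > 0, ∃ β : ℝ → EuclideanSpace ℝ (Fin n), Continuous β ∧ β 0 = x ∧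
      IsSolution f Ω (Icc (-T) T) (fun t => (β t, if t < 0 then u₁ else u₂)) := by
  obtain ⟨S₁, hS₁, β₁, hβ₁, hi₁⟩ := exists_eq_add_integral_of_continuous
    (hf.comp (continuous_id.prodMk (continuous_const (y := u₁)))) x
  obtain ⟨S₂, hS₂, β₂, hβ₂, hi₂⟩ := exists_eq_add_integral_of_continuous
    (hf.comp (continuous_id.prodMk (continuous_const (y := u₂)))) x
  have h0₁ : β₁ 0 = x := by simpa using hi₁ 0 ⟨by linarith, hS₁.le⟩
  have h0₂ : β₂ 0 = x := by simpa using hi₂ 0 ⟨by linarith, hS₂.le⟩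
  have hev : ∀ᶠ t in 𝓝 (0 : ℝ), (β₁ t, u₁) ∈ Ω ∧ (β₂ t, u₂) ∈ Ω :=
    ((hβ₁.prodMk continuous_const).continuousAt.eventually
      (hΩ.mem_nhds (by simpa only [h0₁] using h₁))).and
    ((hβ₂.prodMk continuous_const).continuousAt.eventually
      (hΩ.mem_nhds (by simpa only [h0₂] using h₂)))
  obtain ⟨ε, hε, hεΩ⟩ := Metric.eventually_nhds_iff.1 hev
  let T := min (min S₁ S₂) (ε / 2)
  have hT : 0 < T := by positivity
  have hTS₁ : T ≤ S₁ := (min_le_left _ _).trans (min_le_left _ _)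
  have hTS₂ : T ≤ S₂ := (min_le_left _ _).trans (min_le_right _ _)
  have hTε : T < ε := (min_le_right _ _).trans_lt (half_lt_self hε)
  let β : ℝ → EuclideanSpace ℝ (Fin n) := fun t => if t < 0 then β₁ t else β₂ t
  have hβ : Continuous β := by
    have : β = fun t => if t ≥ 0 then β₂ t else β₁ t := by
      ext1 t; simp only [β, ge_iff_le, ← not_lt, ite_not]
    rw [this]
    exact Continuous.if_le hβ₂ hβ₁ continuous_const continuous_id
      fun t ht => by rw [← ht, h0₁, h0₂]
  let γ : ℝ → StateControl n m := fun t => (β t, if t < 0 then u₁ else u₂)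
  have hγ₁ : ∀ t < 0, γ t = (β₁ t, u₁) := fun t ht => by simp [γ, β, ht]
  have hγ₂ : ∀ t, 0 ≤ t → γ t = (β₂ t, u₂) := fun t ht => by simp [γ, β, not_lt.2 ht]
  have hmeas : Measurable γ :=
    hβ.measurable.prodMk (Measurable.ite measurableSet_Iio measurable_const measurable_const)
  have hmaps : MapsTo γ (Icc (-T) T) Ω := by
    intro t ht
    have h := hεΩ (y := t) (by
      rw [Real.dist_eq, sub_zero]
      exact (abs_le.2 ht).trans_lt hTε)
    rcases lt_or_ge t 0 with h0 | h0
    · rw [hγ₁ t h0]; exact h.1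
    · rw [hγ₂ t h0]; exact h.2
  obtain ⟨C₁, hC₁⟩ := (isCompact_Icc (a := -T) (b := T)).exists_bound_of_continuousOn
    (hf.comp (hβ₁.prodMk (continuous_const (y := u₁)))).continuousOn
  obtain ⟨C₂, hC₂⟩ := (isCompact_Icc (a := -T) (b := T)).exists_bound_of_continuousOn
    (hf.comp (hβ₂.prodMk (continuous_const (y := u₂)))).continuousOn
  have hbound : ∀ t ∈ Icc (-T) T, ‖f (γ t)‖ ≤ max C₁ C₂ := by
    intro t ht
    rcases lt_or_ge t 0 with h0 | h0
    · rw [hγ₁ t h0]; exact (hC₁ t ht).trans (le_max_left _ _)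
    · rw [hγ₂ t h0]; exact (hC₂ t ht).trans (le_max_right _ _)
  have hint : IntegrableOn (fun t => f (γ t)) (Icc (-T) T) :=
    Measure.integrableOn_of_bounded (measure_Icc_lt_top.ne)
      (hf.measurable.comp hmeas).aestronglyMeasurable
      (ae_restrict_of_forall_mem measurableSet_Icc hbound)
  have hii : ∀ a ∈ Icc (-T) T, ∀ b ∈ Icc (-T) T,
      IntervalIntegrable (fun t => f (γ t)) volume a b := fun a ha b hb =>
    (hint.mono_set (uIcc_subset_Icc ha hb)).intervalIntegrable
  have h0mem : (0 : ℝ) ∈ Icc (-T) T := ⟨by linarith, hT.le⟩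
  have hβi : ∀ t ∈ Icc (-T) T, β t = x + ∫ s in (0 : ℝ)..t, f (γ s) := by
    intro t ht
    rcases lt_or_ge t 0 with h0 | h0
    · have : β t = β₁ t := if_pos h0
      rw [this, hi₁ t ⟨by linarith [ht.1], by linarith [ht.2]⟩]
      congr 1
      rw [intervalIntegral.integral_symm, intervalIntegral.integral_symm t]
      congr 1
      -- The endpoint 0 is excluded: there the control is already `u₂`.
      refine intervalIntegral.integral_congr_Ioo_of_le h0.le fun s hs => ?_
      simp only [hγ₁ s hs.2, Function.comp_apply, id]
    · have : β t = β₂ t := if_neg (not_lt.2 h0)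
      rw [this, hi₂ t ⟨by linarith [ht.1], by linarith [ht.2]⟩]
      congr 1
      refine intervalIntegral.integral_congr fun s hs => ?_
      rw [uIcc_of_le h0] at hs
      simp only [hγ₂ s hs.1, Function.comp_apply, id]
  have hsub : ∀ a ∈ Icc (-T) T, ∀ b ∈ Icc (-T) T, β b - β a = ∫ s in a..b, f (γ s) := by
    intro a ha b hb
    rw [hβi a ha, hβi b hb, add_sub_add_left_eq_sub,
      intervalIntegral.integral_interval_sub_left (hii 0 h0mem b hb) (hii 0 h0mem a ha)]
  -- The velocity is bounded, so `β` is Lipschitz and hence absolutely continuous.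
  have hlip : LipschitzOnWith (max C₁ C₂).toNNReal β (Icc (-T) T) := by
    refine LipschitzOnWith.of_dist_le_mul fun b hb a ha => ?_
    rw [dist_eq_norm, hsub a ha b hb, Real.dist_eq]
    refine intervalIntegral.norm_integral_le_of_norm_le_const fun s hs => ?_
    exact (hbound s (uIcc_subset_Icc ha hb (uIoc_subset_uIcc hs))).trans (Real.le_coe_toNNReal _)
  refine ⟨T, hT, β, hβ, (if_neg (lt_irrefl 0)).trans h0₂, hmaps, hmeas.aemeasurable,
    fun t ht => ⟨Icc (-T) T, self_mem_nhdsWithin, ?_⟩, fun a b hab hI => ?_, fun a b hab hI => ?_⟩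
  · refine (((isCompact_Icc (a := -T) (b := T)).image hβ).isBounded.prod
      ((Set.toFinite {u₁, u₂}).isBounded)).subset ?_
    rintro _ ⟨s, hs, rfl⟩
    refine ⟨mem_image_of_mem _ hs, ?_⟩
    simp only [mem_insert_iff, mem_singleton_iff]
    split_ifs <;> simp
  · exact (hlip.mono (by rwa [uIcc_of_le hab])).absolutelyContinuousOnInterval
  · exact hsub a (hI (left_mem_Icc.2 hab)) b (hI (right_mem_Icc.2 hab))

/-! ### The induced map on states. -/

variable {f : StateControl n m → EuclideanSpace ℝ (Fin n)}
  {g : StateControl n' m' → EuclideanSpace ℝ (Fin n')}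
  {χ : OpenPartialHomeomorph (StateControl n m) (StateControl n' m')}

theorem Conjugates.fst_eq (hχ : Conjugates χ f g) (hf : Continuous f)
    {x : EuclideanSpace ℝ (Fin n)} {u₁ u₂ : EuclideanSpace ℝ (Fin m)} (h₁ : (x, u₁) ∈ χ.source)
    (h₂ : (x, u₂) ∈ χ.source) : (χ (x, u₁)).1 = (χ (x, u₂)).1 := by
  obtain ⟨T, hT, β, hβ, h0, hsol⟩ := exists_isSolution_switch hf χ.open_source h₁ h₂
  have hsol' := (hχ _ ordConnected_Icc _ hsol.mapsTo).1 hsol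
  have hle : -T ≤ T := by linarith
  have hc := (hsol'.absolutelyContinuous (-T) T hle subset_rfl).continuousOn
  rw [uIcc_of_le hle] at hc
  have hc0 := (hc.continuousAt (Icc_mem_nhds (neg_lt_zero.2 hT) hT)).tendsto
  -- At time 0 the control is `u₂`, so the limit is `χ_I(x, u₂)`; from the left only `u₁` is seen.
  simp only [h0, lt_irrefl, if_false] at hc0
  have hl : Filter.Tendsto (fun t => (χ (β t, u₁)).1) (𝓝 0) (𝓝 (χ (x, u₁)).1) := by
    have h2 : Filter.Tendsto (fun t => (β t, u₁)) (𝓝 0) (𝓝 (x, u₁)) := by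
      have := (hβ.prodMk (continuous_const (y := u₁))).tendsto 0
      rwa [h0] at this
    exact (continuous_fst.tendsto _).comp ((χ.continuousAt h₁).tendsto.comp h2)
  refine tendsto_nhds_unique ((hl.mono_left (nhdsWithin_le_nhds (s := Iio 0))).congr' ?_)
    (hc0.mono_left nhdsWithin_le_nhds)
  filter_upwards [self_mem_nhdsWithin] with t ht
  simp only [mem_Iio.1 ht, if_true]

open Classical in
/-- The map induced on states by a map of state-control spaces. -/
noncomputable def stateMap (Ω : Set (StateControl n m)) (χ : StateControl n m → StateControl n' m')
    (x : EuclideanSpace ℝ (Fin n)) : EuclideanSpace ℝ (Fin n') :=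
  -- For a conjugation the chosen control is immaterial by `Conjugates.fst_eq`; the value 0 occurs
  -- only off `stateProj Ω`.
  if h : ∃ u, (x, u) ∈ Ω then (χ (x, h.choose)).1 else 0

theorem Conjugates.stateMap_fst (hχ : Conjugates χ f g) (hf : Continuous f) {p : StateControl n m}
    (hp : p ∈ χ.source) : stateMap χ.source χ p.1 = (χ p).1 := by
  have h : ∃ u, (p.1, u) ∈ χ.source := ⟨p.2, hp⟩
  rw [stateMap, dif_pos h]
  exact hχ.fst_eq hf h.choose_spec hp

/-- Since the source is open, the control of a given point stays admissible for nearby states, and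
with it frozen the state map is a slice of `χ_I`. -/
theorem Conjugates.continuousOn_stateMap (hχ : Conjugates χ f g) (hf : Continuous f) :
    ContinuousOn (stateMap χ.source χ) (stateProj χ.source) := by
  rintro _ ⟨p, hp, rfl⟩
  refine ContinuousAt.continuousWithinAt ?_
  have hpair : ContinuousAt (fun x => (x, p.2)) p.1 := by fun_prop
  have hcont : ContinuousAt (fun x => (χ (x, p.2)).1) p.1 :=
    ContinuousAt.fst (ContinuousAt.comp (f := fun x => (x, p.2)) (χ.continuousAt hp) hpair)
  refine hcont.congr ?_
  filter_upwards [hpair.eventually (χ.open_source.mem_nhds hp)] with x hx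
  exact (hχ.stateMap_fst hf hx).symm

theorem Conjugates.mapsTo_stateMap (hχ : Conjugates χ f g) (hf : Continuous f) :
    MapsTo (stateMap χ.source χ) (stateProj χ.source) (stateProj χ.target) := by
  rintro _ ⟨p, hp, rfl⟩
  rw [hχ.stateMap_fst hf hp]
  exact mem_image_of_mem _ (χ.map_source hp)

theorem Conjugates.leftInvOn_stateMap (hχ : Conjugates χ f g) (hf : Continuous f)
    (hg : Continuous g) :
    LeftInvOn (stateMap χ.target χ.symm) (stateMap χ.source χ) (stateProj χ.source) := by
  rintro _ ⟨p, hp, rfl⟩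
  rw [hχ.stateMap_fst hf hp]
  have := hχ.symm.stateMap_fst hg (p := χ p) (χ.map_source hp)
  rwa [χ.left_inv hp] at this

/-- The homeomorphism between the projections onto the state spaces that is induced by a
conjugation. -/
noncomputable def Conjugates.stateHomeomorph (hχ : Conjugates χ f g) (hf : Continuous f)
    (hg : Continuous g) : stateProj χ.source ≃ₜ stateProj χ.target where
  toFun := (hχ.mapsTo_stateMap hf).restrict
  invFun := (hχ.symm.mapsTo_stateMap hg).restrict
  left_inv x := Subtype.ext (hχ.leftInvOn_stateMap hf hg x.2)
  right_inv z := Subtype.ext (hχ.symm.leftInvOn_stateMap hg hf z.2)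
  continuous_toFun := (hχ.continuousOn_stateMap hf).mapsToRestrict _
  continuous_invFun := (hχ.symm.continuousOn_stateMap hg).mapsToRestrict _

theorem Conjugates.state_dim_le (hχ : Conjugates χ f g) (hf : Continuous f) (hg : Continuous g)
    (hne : χ.source.Nonempty) : n ≤ n' := by
  simpa using finrank_le_of_continuousOn_injOn (isOpenMap_fst _ χ.open_source) (hne.image _)
    (hχ.continuousOn_stateMap hf) (hχ.leftInvOn_stateMap hf hg).injOn

theorem add_dim_le (χ : OpenPartialHomeomorph (StateControl n m) (StateControl n' m'))
    (hne : χ.source.Nonempty) : n + m ≤ n' + m' := by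
  simpa using finrank_le_of_continuousOn_injOn χ.open_source hne χ.continuousOn χ.injOn

end ControlSystem

theorem proposition3p2 {n m n' m' : ℕ}
    (f : ControlSystem.StateControl n m → EuclideanSpace ℝ (Fin n))
    (g : ControlSystem.StateControl n' m' → EuclideanSpace ℝ (Fin n'))
    (hf : Continuous f) (hg : Continuous g)
    (Ω : Set (ControlSystem.StateControl n m)) (Ω' : Set (ControlSystem.StateControl n' m'))
    (hΩ : Ω.Nonempty)
    (χ : OpenPartialHomeomorph (ControlSystem.StateControl n m)
      (ControlSystem.StateControl n' m'))
    (hsource : χ.source = Ω) (htarget : χ.target = Ω')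
    (hχ : ControlSystem.Conjugates χ f g) :
    n = n' ∧ m = m' ∧
      (∀ x u₁ u₂, (x, u₁) ∈ Ω → (x, u₂) ∈ Ω → (χ (x, u₁)).1 = (χ (x, u₂)).1) ∧
      ∃ χI : ControlSystem.stateProj Ω ≃ₜ ControlSystem.stateProj Ω',
        ∀ p (hp : p ∈ Ω), (χI ⟨p.1, Set.mem_image_of_mem Prod.fst hp⟩ : EuclideanSpace ℝ (Fin n')) =
          (χ p).1 := by
  subst hsource htarget
  have hne' : χ.symm.source.Nonempty := hΩ.image χ |>.mono χ.mapsTo.image_subset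
  have hn : n = n' := (hχ.state_dim_le hf hg hΩ).antisymm (hχ.symm.state_dim_le hg hf hne')
  have hnm := (ControlSystem.add_dim_le χ hΩ).antisymm (ControlSystem.add_dim_le χ.symm hne')
  exact ⟨hn, by omega, fun x u₁ u₂ h₁ h₂ => hχ.fst_eq hf h₁ h₂,
    hχ.stateHomeomorph hf hg, fun p hp => hχ.stateMap_fst hf hp⟩
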